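/- Let $V$ be a vertex operator algebra over $\mathbb{C}$ with vacuum vector $\mathbf 1$, Virasoro vector $\omega$ and $n$-th products $a_{(n)}b$ $(n\in\mathbb{Z})$; its grading $V=\bigoplus_{n\in\mathbb{Z}}V_n$ by the eigenspaces of $L_0=\omega_{(1)}$ has finite-dimensional pieces, and $V_n=0$ for all sufficiently negative $n$. (It is not required that $V$ be of CFT type, i.e. that $V_n=0$ for $n<0$ and $V_0=\mathbb{C}\mathbf 1$.) Let $d$ be a positive integer, and let $T^d(V)=V^{\otimes d}$ be the tensor product of $d$ copies of $V$, with the $n$-th products $$(a^1\otimes\cdots\otimes a^d)_{(n)}(b^1\otimes\cdots\otimes b^d)=\sum_{k_1+\cdots+k_d=n+1-d}a^1_{(k_1)}b^1\otimes\cdots\otimes a^d_{(k_d)}b^d .$$ The symmetric group $S_d$ acts on $T^d(V)$ by permuting the tensor factors, $\sigma(a^1\otimes\cdots\otimes a^d)=a^{\sigma^{-1}(1)}\otimes\cdots\otimes a^{\sigma^{-1}(d)}$. Let $W=T^d(V)^{S_d}$ be the space of fixed vectors, which is closed under all $n$-th products. Put $$C_2(W)=\operatorname{span}_{\mathbb{C}}\{a_{(-2)}b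 : a,b\in W\},\qquad R(W)=W/C_2(W);$$ $W$ is called $C_2$-cofinite if $\dim R(W)<\infty$. Define linear maps $\eta:V\to W$ and $\overline{\eta}:V\to R(W)$ by $$\eta(a)=\frac{1}{(d-1)!}\sum_{\sigma\in S_d}\sigma(a\otimes\mathbf 1\otimes\cdots\otimes\mathbf 1)=a\otimes\mathbf 1^{\otimes(d-1)}+\mathbf 1\otimes a\otimes\mathbf 1^{\otimes(d-2)}+\cdots+\mathbf 1^{\otimes(d-1)}\otimes a,\qquad \overline{\eta}(a)=\eta(a)+C_2(W).$$ Then $T^d(V)^{S_d}$ is $C_2$-cofinite if and only if the image of $\overline{\eta}$ is finite dimensional. -/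

import Mathlib

open scoped TensorProduct

/-- A (complex) vertex operator algebra structure on `V`, given by its `n`-th products
`prod n a b = a_(n) b`, its vacuum vector, its Virasoro vector `omega` and its central charge.
The Virasoro operators are `L_n = omega_(n+1)`. The sums in the Borcherds identity have only
finitely many nonzero terms, by `truncation`. -/
structure VertexOperatorAlgebra (V : Type*) [AddCommGroup V] [Module ℂ V] where
  /-- The `n`-th product `a_(n) b`. -/
  prod : ℤ → V →ₗ[ℂ] V →ₗ[ℂ] V
  /-- The vacuum vector. -/
  vac : V
  /-- The Virasoro vector. -/
  omega : V
  /-- The central charge. -/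
  centralCharge : ℂ
  truncation : ∀ a b : V, ∃ N : ℤ, ∀ n : ℤ, N ≤ n → prod n a b = 0
  /-- `1_(n) a = δ_{n,-1} a`. -/
  vac_prod : ∀ (n : ℤ) (a : V), prod n vac a = if n = -1 then a else 0
  /-- `a_(n) 1 = 0` for `n ≥ 0`. -/
  prod_vac : ∀ (n : ℤ) (a : V), 0 ≤ n → prod n a vac = 0
  /-- `a_(-1) 1 = a`. -/
  prod_neg_one_vac : ∀ a : V, prod (-1) a vac = a
  /-- The Borcherds identity. -/
  borcherds : ∀ (p q r : ℤ) (a b c : V),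
    ∑ᶠ i : ℕ, Ring.choose p i • prod (p + q - i) (prod (r + i) a b) c =
      ∑ᶠ i : ℕ, ((-1 : ℤ) ^ i * Ring.choose r i) •
        (prod (p + r - i) a (prod (q + i) b c) -
          Int.negOnePow r • prod (q + r - i) b (prod (p + i) a c))
  /-- `[L_m, L_n] = (m - n) L_{m+n} + δ_{m+n,0} (m³ - m)/12 · c`. -/
  virasoro : ∀ (m n : ℤ) (a : V),
    prod (m + 1) omega (prod (n + 1) omega a) - prod (n + 1) omega (prod (m + 1) omega a) =
      ((m : ℂ) - n) • prod (m + n + 1) omega a +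
        (if m + n = 0 then ((m : ℂ) ^ 3 - m) / 12 * centralCharge else 0) • a
  /-- `(L_{-1} a)_(n) = -n a_(n-1)`. -/
  derivation : ∀ (n : ℤ) (a b : V),
    prod n (prod 0 omega a) b = (-(n : ℂ)) • prod (n - 1) a b
  /-- `V` is the direct sum of the eigenspaces `V_n` of `L_0` for the integers `n`. -/
  grading : DirectSum.IsInternal (fun n : ℤ => Module.End.eigenspace (prod 1 omega) (n : ℂ))
  finite_weight : ∀ n : ℤ,
    FiniteDimensional ℂ (Module.End.eigenspace (prod 1 omega) (n : ℂ))
  /-- `V_n = 0` for all sufficiently negative `n`. -/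
  bounded_weight : ∃ N : ℤ, ∀ n : ℤ, n < N → Module.End.eigenspace (prod 1 omega) (n : ℂ) = ⊥

section C2

variable {W : Type*} [AddCommGroup W] [Module ℂ W]

/-- For `n`-th products `Y n a b = a_(n) b` on `W`: the span `C_2(W)` of all `a_(-2) b`. -/
def C2Subspace (Y : ℤ → W →ₗ[ℂ] W →ₗ[ℂ] W) : Submodule ℂ W :=
  Submodule.span ℂ {x | ∃ a b : W, Y (-2) a b = x}

/-- `R(W) = W / C_2(W)`. -/
abbrev C2Quotient (Y : ℤ → W →ₗ[ℂ] W →ₗ[ℂ] W) : Type _ := W ⧸ C2Subspace Y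

/-- `C_2`-cofiniteness: `R(W)` is finite dimensional. -/
def IsC2Cofinite (Y : ℤ → W →ₗ[ℂ] W →ₗ[ℂ] W) : Prop :=
  FiniteDimensional ℂ (C2Quotient Y)

end C2

/-- The tensor power `T^d(V)`, as a vector space. -/
abbrev TPow (V : Type*) [AddCommGroup V] [Module ℂ V] (d : ℕ) : Type _ :=
  PiTensorProduct ℂ (fun _ : Fin d => V)

/-- The action of a permutation on `T^d(V)`:
`σ (a¹ ⊗ ⋯ ⊗ aᵈ) = a^{σ⁻¹(1)} ⊗ ⋯ ⊗ a^{σ⁻¹(d)}`. -/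
noncomputable def permAct (V : Type*) [AddCommGroup V] [Module ℂ V] {d : ℕ}
    (σ : Equiv.Perm (Fin d)) : TPow V d →ₗ[ℂ] TPow V d :=
  (PiTensorProduct.reindex ℂ (fun _ : Fin d => V) σ).toLinearMap

theorem permAct_tprod {V : Type*} [AddCommGroup V] [Module ℂ V] {d : ℕ}
    (σ : Equiv.Perm (Fin d)) (a : Fin d → V) :
    permAct V σ (PiTensorProduct.tprod ℂ a) = PiTensorProduct.tprod ℂ (fun i => a (σ.symm i)) :=
  PiTensorProduct.reindex_tprod σ a

/-- The subspace of vectors of `T^d(V)` that are fixed by all of `S_d`. -/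
def permFixed (V : Type*) [AddCommGroup V] [Module ℂ V] (d : ℕ) : Submodule ℂ (TPow V d) where
  carrier := {x | ∀ σ : Equiv.Perm (Fin d), permAct V σ x = x}
  add_mem' hx hy σ := by rw [map_add, hx σ, hy σ]
  zero_mem' σ := map_zero _
  smul_mem' c x hx σ := by rw [map_smul, hx σ]

namespace VertexOperatorAlgebra

variable {V : Type*} [AddCommGroup V] [Module ℂ V] (A : VertexOperatorAlgebra V) {d : ℕ}

/-- The bilinear map on `T^d(V)` with
`(⊗ aʲ, ⊗ bʲ) ↦ ⊗ (aʲ_(kⱼ) bʲ)`. -/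
noncomputable def modeProd (k : Fin d → ℤ) : TPow V d →ₗ[ℂ] TPow V d →ₗ[ℂ] TPow V d :=
  PiTensorProduct.map₂ (fun i => A.prod (k i))

theorem modeProd_tprod (k : Fin d → ℤ) (a b : Fin d → V) :
    A.modeProd k (PiTensorProduct.tprod ℂ a) (PiTensorProduct.tprod ℂ b) =
      PiTensorProduct.tprod ℂ (fun i => A.prod (k i) (a i) (b i)) :=
  PiTensorProduct.map₂_tprod_tprod _ _ _

theorem finite_modeProd (x y : TPow V d) (m : ℤ) :
    {k : Fin d → ℤ | ∑ i, k i = m ∧ A.modeProd k x y ≠ 0}.Finite := by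
  induction x using PiTensorProduct.induction_on with
  | add x x' hx hx' =>
    refine (hx.union hx').subset ?_
    rintro k ⟨hk, h⟩
    by_contra hc
    simp only [Set.mem_union, Set.mem_ofPred_eq, hk, true_and, not_or, not_not] at hc
    exact h (by rw [map_add, LinearMap.add_apply, hc.1, hc.2, add_zero])
  | smul_tprod r a =>
    induction y using PiTensorProduct.induction_on with
    | add y y' hy hy' =>
      refine (hy.union hy').subset ?_
      rintro k ⟨hk, h⟩
      by_contra hc
      simp only [Set.mem_union, Set.mem_ofPred_eq, hk, true_and, not_or, not_not] at hc
      exact h (by rw [map_add, hc.1, hc.2, add_zero])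
    | smul_tprod s b =>
      choose N hN using fun i => A.truncation (a i) (b i)
      refine (Set.finite_Icc (fun i => m - ∑ j ∈ Finset.univ.erase i, N j) N).subset ?_
      rintro k ⟨hk, h⟩
      have hlt : ∀ i, k i ≤ N i := by
        intro i
        by_contra hc
        apply h
        rw [map_smul, map_smul, LinearMap.smul_apply, modeProd_tprod,
          (PiTensorProduct.tprod ℂ).map_coord_zero i (hN i (k i) (le_of_lt (not_le.mp hc))),
          smul_zero, smul_zero]
      refine ⟨fun i => ?_, hlt⟩
      have h1 : ∑ j ∈ Finset.univ.erase i, k j ≤ ∑ j ∈ Finset.univ.erase i, N j :=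
        Finset.sum_le_sum fun j _ => hlt j
      have h2 := Finset.add_sum_erase Finset.univ k (Finset.mem_univ i)
      change m - ∑ j ∈ Finset.univ.erase i, N j ≤ k i
      linarith

theorem finite_support_modeProd (x y : TPow V d) (m : ℤ) :
    (Function.support
      (fun k : {k : Fin d → ℤ // ∑ i, k i = m} => A.modeProd k.1 x y)).Finite := by
  refine Set.Finite.of_finite_image (f := Subtype.val) ?_ Subtype.val_injective.injOn
  refine (A.finite_modeProd x y m).subset ?_
  rintro _ ⟨k, hk, rfl⟩
  exact ⟨k.2, hk⟩

/-- The `n`-th product of `T^d(V)`. It is the coefficient of `z^{-n-1}` in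
`Y(a¹, z) b¹ ⊗ ⋯ ⊗ Y(aᵈ, z) bᵈ`, where `Y(a, z) = ∑ a_(k) z^{-k-1}`: on pure tensors
`(⊗ aʲ)_(n) (⊗ bʲ) = ∑ ⊗ (aʲ_(kⱼ) bʲ)`, over the `k ∈ ℤᵈ` with `k₁ + ⋯ + k_d = n + 1 - d`
(a sum with finitely many nonzero terms). -/
noncomputable def tensorProd (d : ℕ) (n : ℤ) : TPow V d →ₗ[ℂ] TPow V d →ₗ[ℂ] TPow V d :=
  LinearMap.mk₂ ℂ
    (fun x y => ∑ᶠ k : {k : Fin d → ℤ // ∑ i, k i = n + 1 - d}, A.modeProd k.1 x y)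
    (fun x x' y => by
      simp only [map_add, LinearMap.add_apply]
      exact finsum_add_distrib (A.finite_support_modeProd x y _)
        (A.finite_support_modeProd x' y _))
    (fun c x y => by
      simp only [map_smul, LinearMap.smul_apply]
      rw [smul_finsum])
    (fun x y y' => by
      simp only [map_add]
      exact finsum_add_distrib (A.finite_support_modeProd x y _)
        (A.finite_support_modeProd x y' _))
    (fun c x y => by
      simp only [map_smul]
      rw [smul_finsum])

theorem tensorProd_apply (n : ℤ) (x y : TPow V d) :
    A.tensorProd d n x y =
      ∑ᶠ k : {k : Fin d → ℤ // ∑ i, k i = n + 1 - d}, A.modeProd k.1 x y :=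
  rfl

theorem permAct_modeProd (σ : Equiv.Perm (Fin d)) (k : Fin d → ℤ) (x y : TPow V d) :
    permAct V σ (A.modeProd k x y) =
      A.modeProd (fun i => k (σ.symm i)) (permAct V σ x) (permAct V σ y) := by
  induction x using PiTensorProduct.induction_on with
  | add x x' hx hx' => simp only [map_add, LinearMap.add_apply, hx, hx']
  | smul_tprod r a =>
    induction y using PiTensorProduct.induction_on with
    | add y y' hy hy' => simp only [map_add, hy, hy']
    | smul_tprod s b =>
      simp only [map_smul, LinearMap.smul_apply, modeProd_tprod, permAct_tprod]

/-- Permutations act on `T^d(V)` by automorphisms. -/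
theorem permAct_tensorProd (σ : Equiv.Perm (Fin d)) (n : ℤ) (x y : TPow V d) :
    permAct V σ (A.tensorProd d n x y) =
      A.tensorProd d n (permAct V σ x) (permAct V σ y) := by
  let e : {k : Fin d → ℤ // ∑ i, k i = n + 1 - d} ≃ {k : Fin d → ℤ // ∑ i, k i = n + 1 - d} :=
    (σ.arrowCongr (Equiv.refl ℤ)).subtypeEquiv fun k => by
      have : ∑ i, (σ.arrowCongr (Equiv.refl ℤ)) k i = ∑ i, k i :=
        Equiv.sum_comp σ.symm k
      rw [this]
  rw [tensorProd_apply, tensorProd_apply]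
  refine ((permAct V σ).toAddMonoidHom.map_finsum (A.finite_support_modeProd x y _)).trans ?_
  exact finsum_eq_of_bijective e e.bijective fun k => A.permAct_modeProd σ k.1 x y

theorem tensorProd_mem_permFixed (n : ℤ) {x y : TPow V d} (hx : x ∈ permFixed V d)
    (hy : y ∈ permFixed V d) : A.tensorProd d n x y ∈ permFixed V d := fun σ => by
  rw [A.permAct_tensorProd, hx σ, hy σ]

/-- The `n`-th product of the orbifold `T^d(V)^{S_d}`, the restriction of that of `T^d(V)`. -/
noncomputable def orbifoldProd (d : ℕ) (n : ℤ) :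
    permFixed V d →ₗ[ℂ] permFixed V d →ₗ[ℂ] permFixed V d :=
  LinearMap.mk₂ ℂ
    (fun x y => ⟨A.tensorProd d n x y, A.tensorProd_mem_permFixed n x.2 y.2⟩)
    (fun x x' y => Subtype.ext (by simp))
    (fun c x y => Subtype.ext (by simp))
    (fun x y y' => Subtype.ext (by simp))
    (fun c x y => Subtype.ext (by simp))

/-- `a ↦ a ⊗ 1 ⊗ ⋯ ⊗ 1 + 1 ⊗ a ⊗ 1 ⊗ ⋯ ⊗ 1 + ⋯ + 1 ⊗ ⋯ ⊗ 1 ⊗ a`, as a map to `T^d(V)`. -/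
noncomputable def etaTensor (d : ℕ) : V →ₗ[ℂ] TPow V d :=
  ∑ i : Fin d, (PiTensorProduct.tprod ℂ).toLinearMap (fun _ => A.vac) i

theorem etaTensor_apply (a : V) :
    A.etaTensor d a =
      ∑ i : Fin d, PiTensorProduct.tprod ℂ (Function.update (fun _ => A.vac) i a) := by
  simp [etaTensor]

theorem permAct_tprod_update (σ : Equiv.Perm (Fin d)) (i : Fin d) (a : V) :
    permAct V σ (PiTensorProduct.tprod ℂ (Function.update (fun _ => A.vac) i a)) =
      PiTensorProduct.tprod ℂ (Function.update (fun _ => A.vac) (σ i) a) := by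
  rw [permAct_tprod]
  congr 1
  funext j
  by_cases h : j = σ i
  · subst h; simp
  · have h' : σ.symm j ≠ i := fun hc => h (by rw [← hc]; simp)
    rw [Function.update_of_ne h, Function.update_of_ne h']

/-- `η` is also `1/(d-1)!` times the sum of all `σ (a ⊗ 1 ⊗ ⋯ ⊗ 1)`, `σ ∈ S_d`
(here with `d = m + 1`). -/
theorem etaTensor_eq_symmetrised (m : ℕ) (a : V) :
    A.etaTensor (m + 1) a = ((m.factorial : ℂ))⁻¹ • ∑ σ : Equiv.Perm (Fin (m + 1)),
      permAct V σ (PiTensorProduct.tprod ℂ (Function.update (fun _ => A.vac) 0 a)) := by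
  have hm : (m.factorial : ℂ) ≠ 0 := Nat.cast_ne_zero.mpr m.factorial_ne_zero
  rw [etaTensor_apply]
  simp only [permAct_tprod_update]
  rw [← Equiv.sum_comp Equiv.Perm.decomposeFin.symm, Fintype.sum_prod_type]
  simp only [Equiv.Perm.decomposeFin_symm_apply_zero, Finset.sum_const, Finset.card_univ,
    Fintype.card_perm, Fintype.card_fin]
  simp only [← Nat.cast_smul_eq_nsmul ℂ]
  rw [← Finset.smul_sum, smul_smul, inv_mul_cancel₀ hm, one_smul]

theorem etaTensor_mem_permFixed (a : V) : A.etaTensor d a ∈ permFixed V d := fun σ => by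
  rw [etaTensor_apply, map_sum]
  simp only [permAct_tprod_update]
  exact Equiv.sum_comp σ
    (fun i => PiTensorProduct.tprod ℂ (Function.update (fun _ => A.vac) i a))

/-- The linear map `η : V → T^d(V)^{S_d}`. -/
noncomputable def eta (d : ℕ) : V →ₗ[ℂ] permFixed V d :=
  (A.etaTensor d).codRestrict (permFixed V d) A.etaTensor_mem_permFixed

/-- The linear map `η̄ : V → R(T^d(V)^{S_d})`, the class of `η` modulo `C_2(T^d(V)^{S_d})`. -/
noncomputable def etaBar (d : ℕ) : V →ₗ[ℂ] C2Quotient (A.orbifoldProd d) :=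
  (C2Subspace (A.orbifoldProd d)).mkQ ∘ₗ A.eta d

end VertexOperatorAlgebra

/-! Only the "if" direction has content. The operators `η(a)_(m)` act on `T^d(V)` as the sum over
the slots of `a_(m)`, and a commutator formula holds for them. Together with `(D x)_(n) = -n
x_(n-1)` for `D = η(ω)_(0)`, it shows that `η(ω)_(1)` and all `η(a)_(-1)` preserve `C_2(W)`.

Hence `ker η̄` is stable under `L_0`. If `η̄` has finite rank, `L_0` has finitely many eigenvalues
on `V / ker η̄`, so `η(a) ∈ C_2(W)` for every `a` of large weight (`exists_eta_mem_C2Subspace`).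

This passes to symmetrised pure tensors with an entry of large weight, by induction on the number of
slots allowed to be non-vacuum (`symmetrise_tprod_mem_C2Subspace`): `η(b)_(-1)` inserts `b` into a
vacuum slot, up to terms that multiply an existing entry by `b`. Such a product can lower the weight
by a bounded amount `M`, as weights are bounded below, so the threshold grows by `M` per slot.
Vectors of large weight span a subspace of finite codimension, so `R(W)` is the image of a tensor
power of a finite-dimensional space. -/

namespace VertexOperatorAlgebra

variable {V : Type*} [AddCommGroup V] [Module ℂ V] (A : VertexOperatorAlgebra V) {d : ℕ}

/-! ### Commutator and translation formulas on `T^d(V)` -/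

/-- The commutator formula `[a_(p), b_(q)] = ∑ j, (p choose j) (a_(j) b)_(p + q - j)`. -/
theorem prod_commutator (p q : ℤ) (a b c : V) {N : ℕ}
    (hN : ∀ j : ℕ, N ≤ j → A.prod j a b = 0) :
    A.prod p a (A.prod q b c) - A.prod q b (A.prod p a c) =
      ∑ j ∈ Finset.range N, ((Ring.choose p j : ℤ) : ℂ) • A.prod (p + q - j) (A.prod j a b) c := by
  -- At `r = 0` the right-hand side keeps only `i = 0`, because `(0 choose i) = 0` otherwise.
  have h := A.borcherds p q 0 a b c
  rw [finsum_eq_sum_of_support_subset (s := Finset.range N),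
    finsum_eq_single _ 0] at h
  · simpa [Int.cast_smul_eq_zsmul] using h.symm
  · intro i hi
    simp [Ring.choose_zero_ite, hi]
  · intro i hi
    by_contra hc
    simp only [Finset.coe_range, Set.mem_Iio, not_lt] at hc
    exact hi (by simp [hN i hc])

/-- The operator `a_(m)` on the `i`-th tensor factor of `T^d(V)`. -/
noncomputable def factorAct (i : Fin d) (m : ℤ) (a : V) : TPow V d →ₗ[ℂ] TPow V d :=
  PiTensorProduct.map (Function.update (fun _ => LinearMap.id) i (A.prod m a))

theorem factorAct_tprod (i : Fin d) (m : ℤ) (a : V) (v : Fin d → V) :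
    A.factorAct i m a (PiTensorProduct.tprod ℂ v) =
      PiTensorProduct.tprod ℂ (Function.update v i (A.prod m a (v i))) := by
  rw [factorAct, PiTensorProduct.map_tprod]
  congr 1
  funext l
  by_cases h : l = i
  · subst h; simp
  · simp [h]

/-- `η(a)_(m)` is the sum of the operators `a_(m)` on the tensor factors. -/
theorem tensorProd_etaTensor (m : ℤ) (a : V) (y : TPow V d) :
    A.tensorProd d m (A.etaTensor d a) y = ∑ i, A.factorAct i m a y := by
  rw [etaTensor_apply, map_sum, LinearMap.sum_apply]
  refine Finset.sum_congr rfl fun i _ => ?_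
  induction y using PiTensorProduct.induction_on with
  | add y y' hy hy' => rw [map_add, map_add, hy, hy']
  | smul_tprod r v =>
    rw [map_smul, map_smul]
    congr 1
    -- Since `1_(k) = δ_{k,-1}`, the vacuum slots force mode `-1`, leaving exactly mode `m` for slot
    -- `i`.
    have hk : ∑ l, Function.update (fun _ : Fin d => (-1 : ℤ)) i m l = m + 1 - d := by
      rw [Finset.sum_update_of_mem (Finset.mem_univ i)]
      have : 0 < d := i.pos
      simp [Finset.card_sdiff, Nat.cast_sub (Nat.one_le_of_lt this)]
      ring
    rw [tensorProd_apply, finsum_eq_single _ ⟨_, hk⟩, modeProd_tprod, factorAct_tprod]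
    · congr 1
      funext l
      by_cases h : l = i
      · subst h; simp
      · simp [h, A.vac_prod]
    · rintro ⟨k, hk'⟩ hne
      rw [modeProd_tprod]
      have : ∃ l, l ≠ i ∧ k l ≠ -1 := by
        by_contra! hc
        apply hne
        have hki : k = Function.update (fun _ : Fin d => (-1 : ℤ)) i (k i) := by
          funext l
          by_cases h : l = i
          · subst h; simp
          · simp [h, hc l h]
        have h1 : k i = m := by
          rw [hki, Finset.sum_update_of_mem (Finset.mem_univ i)] at hk'
          rw [Finset.sum_update_of_mem (Finset.mem_univ i)] at hk
          linarith
        exact Subtype.ext (hki.trans (by rw [h1]))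
      obtain ⟨l, hl, hkl⟩ := this
      refine (PiTensorProduct.tprod ℂ).map_coord_zero l ?_
      simp [hl, A.vac_prod, hkl]

/-- Only slot `i` changes, so this is the one-factor commutator formula plus multilinearity. The
bound depends on `a` and `x` alone, so that one finite sum over `j` serves all `k` at once; allowing
any `N ≥ N₀` makes the statement additive in `x`. -/
theorem exists_factorAct_modeProd_commutator (a : V) (x : TPow V d) :
    ∃ N₀ : ℕ, ∀ N, N₀ ≤ N → ∀ (i : Fin d) (m : ℤ) (k : Fin d → ℤ) (y : TPow V d),
      A.factorAct i m a (A.modeProd k x y) - A.modeProd k x (A.factorAct i m a y) =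
        ∑ j ∈ Finset.range N, ((Ring.choose m j : ℤ) : ℂ) •
          A.modeProd (Function.update k i (k i + (m - j))) (A.factorAct i j a x) y := by
  induction x using PiTensorProduct.induction_on with
  | add x x' hx hx' =>
    obtain ⟨N₁, h₁⟩ := hx
    obtain ⟨N₂, h₂⟩ := hx'
    refine ⟨max N₁ N₂, fun N hN i m k y => ?_⟩
    have e₁ := h₁ N (le_trans (le_max_left _ _) hN) i m k y
    have e₂ := h₂ N (le_trans (le_max_right _ _) hN) i m k y
    simp only [map_add, LinearMap.add_apply, smul_add, Finset.sum_add_distrib, ← e₁, ← e₂]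
    abel
  | smul_tprod r u =>
    choose N₁ hN₁ using fun i => A.truncation a (u i)
    refine ⟨Finset.univ.sup fun i => (N₁ i).toNat, fun N hN i m k y => ?_⟩
    have hz : ∀ j : ℕ, N ≤ j → A.prod j a (u i) = 0 := fun j hj => hN₁ i j <| by
      have h := (Finset.le_sup (f := fun i => (N₁ i).toNat) (Finset.mem_univ i)).trans (hN.trans hj)
      exact Int.toNat_le.mp h
    induction y using PiTensorProduct.induction_on with
    | add y y' hy hy' =>
      simp only [map_add, smul_add, Finset.sum_add_distrib, ← hy, ← hy']
      abel
    | smul_tprod s v =>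
      have key : A.factorAct i m a
            (A.modeProd k (PiTensorProduct.tprod ℂ u) (PiTensorProduct.tprod ℂ v)) -
          A.modeProd k (PiTensorProduct.tprod ℂ u)
            (A.factorAct i m a (PiTensorProduct.tprod ℂ v)) =
          ∑ j ∈ Finset.range N, ((Ring.choose m j : ℤ) : ℂ) •
            A.modeProd (Function.update k i (k i + (m - j)))
              (A.factorAct i j a (PiTensorProduct.tprod ℂ u)) (PiTensorProduct.tprod ℂ v) := by
        have e₁ : (fun l => A.prod (k l) (u l) (Function.update v i (A.prod m a (v i)) l)) =
            Function.update (fun l => A.prod (k l) (u l) (v l)) i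
              (A.prod (k i) (u i) (A.prod m a (v i))) := by
          funext l
          by_cases h : l = i
          · subst h; simp
          · simp [h]
        have e₂ : ∀ j : ℕ, (fun l => A.prod (Function.update k i (k i + (m - j)) l)
              (Function.update u i (A.prod j a (u i)) l) (v l)) =
            Function.update (fun l => A.prod (k l) (u l) (v l)) i
              (A.prod (m + k i - j) (A.prod j a (u i)) (v i)) := by
          intro j
          funext l
          by_cases h : l = i
          · subst h
            simp only [Function.update_self]
            rw [show k l + (m - (j : ℤ)) = m + k l - j by ring]
          · simp [h]
        simp only [modeProd_tprod, factorAct_tprod, e₁, e₂]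
        rw [← MultilinearMap.map_update_sub, A.prod_commutator m (k i) a (u i) (v i) hz,
          MultilinearMap.map_update_sum]
        refine Finset.sum_congr rfl fun j _ => ?_
        rw [MultilinearMap.map_update_smul]
      simp only [map_smul, LinearMap.smul_apply, smul_comm _ r]
      rw [← smul_sub, ← Finset.smul_sum]
      congr 1
      simp only [smul_comm _ s]
      rw [← smul_sub, ← Finset.smul_sum, key]

/-- Reindexing of the sum over modes by a shift in one coordinate. -/
theorem finsum_modeProd_update (i : Fin d) (c s n : ℤ) (h : s + c = n + 1 - d) (x y : TPow V d) :
    ∑ᶠ k : {k : Fin d → ℤ // ∑ l, k l = s},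
      A.modeProd (Function.update k.1 i (k.1 i + c)) x y = A.tensorProd d n x y := by
  rw [tensorProd_apply]
  have hsum : ∀ (k : Fin d → ℤ) (e : ℤ), ∑ l, (k + Pi.single (M := fun _ => ℤ) i e) l = ∑ l, k l + e := by
    intro k e
    simp [Finset.sum_add_distrib]
  let e : {k : Fin d → ℤ // ∑ l, k l = s} ≃ {k : Fin d → ℤ // ∑ l, k l = n + 1 - d} :=
    (Equiv.addRight (Pi.single (M := fun _ => ℤ) i c)).subtypeEquiv fun k => by
      have := hsum k c
      simp only [Equiv.coe_addRight]
      constructor <;> intro h' <;> linarith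
  refine finsum_eq_of_bijective e e.bijective fun k => ?_
  congr 3
  funext l
  change _ = k.1 l + Pi.single (M := fun _ => ℤ) i c l
  by_cases hl : l = i
  · subst hl; simp
  · simp [hl]

theorem finite_support_modeProd_update (i : Fin d) (c s : ℤ) (x y : TPow V d) :
    (Function.support fun k : {k : Fin d → ℤ // ∑ l, k l = s} =>
      A.modeProd (Function.update k.1 i (k.1 i + c)) x y).Finite := by
  refine Set.Finite.of_finite_image
    (f := fun k => Function.update k.1 i (k.1 i + c)) ?_ ?_
  · refine (A.finite_modeProd x y (s + c)).subset ?_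
    rintro _ ⟨k, hk, rfl⟩
    refine ⟨?_, hk⟩
    have h₁ := Finset.add_sum_erase Finset.univ k.1 (Finset.mem_univ i)
    have h₂ := k.2
    rw [Finset.sum_update_of_mem (Finset.mem_univ i), Finset.sdiff_singleton_eq_erase]
    linarith
  · rintro k - k' - hkk'
    refine Subtype.ext (funext fun l => ?_)
    have := congrFun hkk' l
    by_cases hl : l = i
    · subst hl; simpa using this
    · simpa [hl] using this

/-- The commutator formula in `T^d(V)`, for `η(a)`. -/
theorem exists_tensorProd_etaTensor_commutator (a : V) (x : TPow V d) :
    ∃ N : ℕ, ∀ (m n : ℤ) (y : TPow V d),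
      A.tensorProd d m (A.etaTensor d a) (A.tensorProd d n x y) -
        A.tensorProd d n x (A.tensorProd d m (A.etaTensor d a) y) =
      ∑ j ∈ Finset.range N, ((Ring.choose m j : ℤ) : ℂ) •
        A.tensorProd d (m + n - j) (A.tensorProd d j (A.etaTensor d a) x) y := by
  obtain ⟨N, hN⟩ := A.exists_factorAct_modeProd_commutator a x
  refine ⟨N, fun m n y => ?_⟩
  simp only [tensorProd_etaTensor, map_sum, LinearMap.sum_apply, Finset.smul_sum]
  rw [Finset.sum_comm (s := Finset.range N), ← Finset.sum_sub_distrib]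
  refine Finset.sum_congr rfl fun i _ => ?_
  have h₁ : A.factorAct i m a (A.tensorProd d n x y) =
      ∑ᶠ k : {k : Fin d → ℤ // ∑ l, k l = n + 1 - d}, A.factorAct i m a (A.modeProd k.1 x y) :=
    (A.factorAct i m a).toAddMonoidHom.map_finsum (A.finite_support_modeProd x y _)
  rw [h₁, tensorProd_apply A n x, ← finsum_sub_distrib
    ((A.finite_support_modeProd x y _).subset fun k hk hc => hk (by simp only [hc, map_zero]))
    (A.finite_support_modeProd x _ _)]
  simp only [hN N le_rfl]
  rw [finsum_sum_comm]
  · refine Finset.sum_congr rfl fun j _ => ?_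
    -- Shifting `k i` by `m - j` turns total mode `n + 1 - d` into `(m + n - j) + 1 - d`.
    rw [← A.finsum_modeProd_update i (m - j) (n + 1 - d) (m + n - j) (by ring), smul_finsum]
  · intro j _
    exact (A.finite_support_modeProd_update i (m - j) _ (A.factorAct i j a x) y).subset fun k hk hc => hk (by
      simp only [hc, smul_zero])

theorem modeProd_factorAct_omega (i : Fin d) (k : Fin d → ℤ) (x y : TPow V d) :
    A.modeProd k (A.factorAct i 0 A.omega x) y =
      (-(k i : ℂ)) • A.modeProd (Function.update k i (k i + (-1))) x y := by
  induction x using PiTensorProduct.induction_on with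
  | add x x' hx hx' => simp only [map_add, LinearMap.add_apply, smul_add, hx, hx']
  | smul_tprod r u =>
    induction y using PiTensorProduct.induction_on with
    | add y y' hy hy' => simp only [map_add, smul_add, hy, hy']
    | smul_tprod s v =>
      have e₁ : (fun l => A.prod (k l) (Function.update u i (A.prod 0 A.omega (u i)) l) (v l)) =
          Function.update (fun l => A.prod (k l) (u l) (v l)) i
            ((-(k i : ℂ)) • A.prod (k i - 1) (u i) (v i)) := by
        funext l
        by_cases h : l = i
        · subst h; simp [A.derivation]
        · simp [h]
      have e₂ : (fun l => A.prod (Function.update k i (k i + (-1)) l) (u l) (v l)) =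
          Function.update (fun l => A.prod (k l) (u l) (v l)) i
            (A.prod (k i - 1) (u i) (v i)) := by
        funext l
        by_cases h : l = i
        · subst h; simp [sub_eq_add_neg]
        · simp [h]
      simp only [map_smul, LinearMap.smul_apply, factorAct_tprod, modeProd_tprod, e₁, e₂,
        MultilinearMap.map_update_smul]
      simp only [smul_comm _ r]
      congr 1
      rw [smul_comm]

/-- `(D x)_(n) = -n x_(n-1)` for the translation operator `D = η(ω)_(0)` of `T^d(V)`. -/
theorem tensorProd_derivation (n : ℤ) (x y : TPow V d) :
    A.tensorProd d n (A.tensorProd d 0 (A.etaTensor d A.omega) x) y =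
      (-(n : ℂ)) • A.tensorProd d (n - 1) x y := by
  -- After shifting `k i` down by one, the coefficient `-k i` reads `-(k i + 1)`. Summed over `i` it
  -- is `-((n - d) + d) = -n`, independent of `k`.
  have key : ∀ i : Fin d, A.tensorProd d n (A.factorAct i 0 A.omega x) y =
      ∑ᶠ k : {k : Fin d → ℤ // ∑ l, k l = n - 1 + 1 - d},
        (-((k.1 i + 1 : ℤ) : ℂ)) • A.modeProd k.1 x y := by
    intro i
    have hsum : ∀ (k : Fin d → ℤ) (e : ℤ), ∑ l, (k + Pi.single (M := fun _ => ℤ) i e) l = ∑ l, k l + e := by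
      intro k e
      simp [Finset.sum_add_distrib]
    let e : {k : Fin d → ℤ // ∑ l, k l = n + 1 - d} ≃
        {k : Fin d → ℤ // ∑ l, k l = n - 1 + 1 - d} :=
      (Equiv.addRight (Pi.single (M := fun _ => ℤ) i (-1))).subtypeEquiv fun k => by
        have := hsum k (-1)
        simp only [Equiv.coe_addRight]
        constructor <;> intro h' <;> linarith
    rw [tensorProd_apply]
    refine finsum_eq_of_bijective e e.bijective fun k => ?_
    have he : (e k).1 = Function.update k.1 i (k.1 i + (-1)) := by
      funext l
      change k.1 l + Pi.single (M := fun _ => ℤ) i (-1) l = _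
      by_cases hl : l = i
      · subst hl; simp
      · simp [hl]
    rw [modeProd_factorAct_omega, he]
    simp
  rw [tensorProd_etaTensor, map_sum, LinearMap.sum_apply]
  simp only [key]
  rw [← finsum_sum_comm]
  · rw [tensorProd_apply, smul_finsum]
    refine finsum_congr fun k => ?_
    rw [← Finset.sum_smul]
    congr 1
    have := k.2
    rw [Finset.sum_neg_distrib, ← Int.cast_sum, Finset.sum_add_distrib, this]
    simp
  · intro i _
    exact (A.finite_support_modeProd x y _).subset fun k hk hc => hk (by
      simp only [hc, smul_zero])

end VertexOperatorAlgebra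

/-! ### Symmetrisation -/

section Symmetrisation

variable (V : Type*) [AddCommGroup V] [Module ℂ V] {d : ℕ}

theorem permAct_permAct (σ τ : Equiv.Perm (Fin d)) (x : TPow V d) :
    permAct V σ (permAct V τ x) = permAct V (σ * τ) x := by
  induction x using PiTensorProduct.induction_on with
  | add x x' hx hx' => simp only [map_add, hx, hx']
  | smul_tprod r a =>
    simp only [map_smul, permAct_tprod]
    rfl

/-- The unnormalised symmetrisation `x ↦ ∑ σ, σ x`. -/
noncomputable def symmetrise (d : ℕ) : TPow V d →ₗ[ℂ] permFixed V d :=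
  (∑ σ : Equiv.Perm (Fin d), permAct V σ).codRestrict (permFixed V d) fun x τ => by
    simp only [LinearMap.sum_apply, map_sum, permAct_permAct]
    exact Equiv.sum_comp (Equiv.mulLeft τ) fun σ => permAct V σ x

theorem coe_symmetrise (x : TPow V d) :
    (symmetrise V d x : TPow V d) = ∑ σ : Equiv.Perm (Fin d), permAct V σ x :=
  LinearMap.sum_apply _ _ _

theorem symmetrise_permAct (τ : Equiv.Perm (Fin d)) (x : TPow V d) :
    symmetrise V d (permAct V τ x) = symmetrise V d x := by
  refine Subtype.ext ?_
  simp only [coe_symmetrise, permAct_permAct]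
  exact Equiv.sum_comp (Equiv.mulRight τ) fun σ => permAct V σ x

theorem symmetrise_coe (x : permFixed V d) :
    symmetrise V d (x : TPow V d) = (d.factorial : ℂ) • x := by
  refine Subtype.ext ?_
  rw [coe_symmetrise, Finset.sum_congr rfl fun σ _ => x.2 σ]
  simp [Fintype.card_perm, Nat.cast_smul_eq_nsmul]

/-- Division by `d!` is possible over `ℂ`; this reduces questions about `W` to symmetrised pure
tensors. -/
theorem range_symmetrise : LinearMap.range (symmetrise V d) = ⊤ := by
  refine LinearMap.range_eq_top.mpr fun x => ⟨((d.factorial : ℂ)⁻¹ • x : permFixed V d), ?_⟩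
  rw [symmetrise_coe, smul_smul,
    mul_inv_cancel₀ (Nat.cast_ne_zero.mpr d.factorial_ne_zero), one_smul]

end Symmetrisation

/-- A linear map out of a tensor power has finite rank if it kills all pure tensors with an entry
in a subspace of finite codimension. -/
theorem PiTensorProduct.finiteDimensional_range_of_forall_tprod_eq_zero {ι V R : Type*} [Fintype ι]
    [AddCommGroup V] [Module ℂ V] [AddCommGroup R] [Module ℂ R]
    (φ : PiTensorProduct ℂ (fun _ : ι => V) →ₗ[ℂ] R) (F G : Submodule ℂ V)
    [FiniteDimensional ℂ G] (hGF : G ⊔ F = ⊤)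
    (h : ∀ (a : ι → V) (i : ι), a i ∈ F → φ (PiTensorProduct.tprod ℂ a) = 0) :
    FiniteDimensional ℂ (LinearMap.range φ) := by
  classical
  let ψ : PiTensorProduct ℂ (fun _ : ι => G) →ₗ[ℂ] R :=
    φ ∘ₗ PiTensorProduct.map fun _ => G.subtype
  refine Submodule.finiteDimensional_of_le (S₂ := LinearMap.range ψ) ?_
  rw [LinearMap.range_eq_map, ← PiTensorProduct.span_tprod_eq_top, Submodule.map_span,
    Submodule.span_le]
  rintro _ ⟨_, ⟨a, rfl⟩, rfl⟩
  have ha : ∀ i, ∃ g ∈ G, ∃ f ∈ F, g + f = a i := fun i =>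
    Submodule.mem_sup.mp (hGF ▸ Submodule.mem_top)
  choose g hg f hf hgf using ha
  refine ⟨PiTensorProduct.tprod ℂ fun i => ⟨g i, hg i⟩, ?_⟩
  have hadd : a = g + f := funext fun i => (hgf i).symm
  -- Of the `2^|ι|` terms of the expansion, only the one with all entries in `G` survives.
  rw [hadd, MultilinearMap.map_add_univ, map_sum, Finset.sum_eq_single Finset.univ]
  · simp [ψ, PiTensorProduct.map_tprod]
  · intro s _ hs
    obtain ⟨i, hi⟩ : ∃ i, i ∉ s := by
      by_contra! hc
      exact hs (Finset.eq_univ_of_forall hc)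
    exact h _ i (by simpa [hi] using hf i)
  · simp

/-! ### Operators preserving `C_2(W)` -/

namespace VertexOperatorAlgebra

variable {V : Type*} [AddCommGroup V] [Module ℂ V] (A : VertexOperatorAlgebra V) {d : ℕ}

theorem coe_orbifoldProd (n : ℤ) (x y : permFixed V d) :
    (A.orbifoldProd d n x y : TPow V d) = A.tensorProd d n x y :=
  rfl

theorem coe_eta (a : V) : (A.eta d a : TPow V d) = A.etaTensor d a :=
  rfl

theorem exists_orbifoldProd_eta_commutator (a : V) (x : permFixed V d) :
    ∃ N : ℕ, ∀ (m n : ℤ) (y : permFixed V d),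
      A.orbifoldProd d m (A.eta d a) (A.orbifoldProd d n x y) =
        A.orbifoldProd d n x (A.orbifoldProd d m (A.eta d a) y) +
      ∑ j ∈ Finset.range N, ((Ring.choose m j : ℤ) : ℂ) •
        A.orbifoldProd d (m + n - j) (A.orbifoldProd d j (A.eta d a) x) y := by
  obtain ⟨N, hN⟩ := A.exists_tensorProd_etaTensor_commutator a (x : TPow V d)
  refine ⟨N, fun m n y => Subtype.ext ?_⟩
  have := hN m n y
  simp only [Submodule.coe_add, AddSubmonoidClass.coe_finsetSum, Submodule.coe_smul,
    coe_orbifoldProd, coe_eta, ← this]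
  abel

theorem orbifoldProd_derivation (n : ℤ) (x y : permFixed V d) :
    A.orbifoldProd d n (A.orbifoldProd d 0 (A.eta d A.omega) x) y =
      (-(n : ℂ)) • A.orbifoldProd d (n - 1) x y :=
  Subtype.ext (A.tensorProd_derivation n (x : TPow V d) (y : TPow V d))

/-- Replacing `x` by `D x` lowers the mode by one, up to the factor `2 + j ≠ 0`. -/
theorem orbifoldProd_mem_C2Subspace (j : ℕ) (x y : permFixed V d) :
    A.orbifoldProd d (-2 - j) x y ∈ C2Subspace (A.orbifoldProd d) := by
  induction j generalizing x with
  | zero => exact Submodule.subset_span ⟨x, y, by simp⟩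
  | succ j ih =>
    have h := ih (A.orbifoldProd d 0 (A.eta d A.omega) x)
    rw [orbifoldProd_derivation] at h
    have hne : (-((-2 - j : ℤ) : ℂ)) ≠ 0 := by
      rw [← Int.cast_neg]
      exact Int.cast_ne_zero.mpr (by omega)
    have h' := (Submodule.smul_mem_iff _ hne).mp h
    rwa [show (-2 - ((j + 1 : ℕ) : ℤ)) = -2 - j - 1 by push_cast; ring]

/-- The operators `η(a)_(-1)` preserve `C_2(W)`. -/
theorem orbifoldProd_eta_neg_one_mem_C2Subspace (a : V) {z : permFixed V d}
    (hz : z ∈ C2Subspace (A.orbifoldProd d)) :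
    A.orbifoldProd d (-1) (A.eta d a) z ∈ C2Subspace (A.orbifoldProd d) := by
  induction hz using Submodule.span_induction with
  | zero => rw [map_zero]; exact Submodule.zero_mem _
  | add x y _ _ hx hy => rw [map_add]; exact Submodule.add_mem _ hx hy
  | smul c x _ hx => rw [map_smul]; exact Submodule.smul_mem _ _ hx
  | mem z hz =>
    obtain ⟨x, y, rfl⟩ := hz
    obtain ⟨N, hN⟩ := A.exists_orbifoldProd_eta_commutator a x
    rw [hN]
    refine Submodule.add_mem _ (Submodule.subset_span ⟨_, _, rfl⟩)
      (Submodule.sum_mem _ fun j _ => Submodule.smul_mem _ _ ?_)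
    rw [show (-1 + -2 - j : ℤ) = -2 - ((j + 1 : ℕ) : ℤ) by push_cast; ring]
    exact A.orbifoldProd_mem_C2Subspace _ _ _

/-- `η(ω)_(1)`, the `L_0` operator of `W`, preserves `C_2(W)`. -/
theorem orbifoldProd_eta_omega_mem_C2Subspace {z : permFixed V d}
    (hz : z ∈ C2Subspace (A.orbifoldProd d)) :
    A.orbifoldProd d 1 (A.eta d A.omega) z ∈ C2Subspace (A.orbifoldProd d) := by
  induction hz using Submodule.span_induction with
  | zero => rw [map_zero]; exact Submodule.zero_mem _
  | add x y _ _ hx hy => rw [map_add]; exact Submodule.add_mem _ hx hy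
  | smul c x _ hx => rw [map_smul]; exact Submodule.smul_mem _ _ hx
  | mem z hz =>
    obtain ⟨x, y, rfl⟩ := hz
    obtain ⟨N, hN⟩ := A.exists_orbifoldProd_eta_commutator A.omega x
    rw [hN]
    refine Submodule.add_mem _ (Submodule.subset_span ⟨_, _, rfl⟩)
      (Submodule.sum_mem _ fun j _ => Submodule.smul_mem _ _ ?_)
    -- The modes are `-1 - j`. The term `j = 0` has mode `-1`, but it is `(D x)_(-1) y = x_(-2) y`.
    rcases j with _ | j
    · rw [Nat.cast_zero, orbifoldProd_derivation]
      exact Submodule.smul_mem _ _ (Submodule.subset_span ⟨_, _, rfl⟩)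
    · rw [show (1 + -2 - ((j + 1 : ℕ) : ℤ) : ℤ) = -2 - j by push_cast; ring]
      exact A.orbifoldProd_mem_C2Subspace _ _ _

/-- As `η(b)` is fixed by `S_d`, its modes commute with symmetrisation. -/
theorem orbifoldProd_eta_symmetrise (m : ℤ) (b : V) (a : Fin d → V) :
    A.orbifoldProd d m (A.eta d b) (symmetrise V d (PiTensorProduct.tprod ℂ a)) =
      ∑ i, symmetrise V d
        (PiTensorProduct.tprod ℂ (Function.update a i (A.prod m b (a i)))) := by
  have h : ∀ x : TPow V d, A.orbifoldProd d m (A.eta d b) (symmetrise V d x) =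
      symmetrise V d (A.tensorProd d m (A.etaTensor d b) x) := by
    refine fun x => Subtype.ext ?_
    rw [coe_orbifoldProd, coe_symmetrise, coe_symmetrise, map_sum, coe_eta]
    refine Finset.sum_congr rfl fun σ _ => ?_
    rw [permAct_tensorProd, A.etaTensor_mem_permFixed b σ]
  rw [h, tensorProd_etaTensor, map_sum]
  simp only [factorAct_tprod]

/-- Since `ω_(1) 1 = 0`, only the slot holding `a` contributes. This makes the kernel of `η̄` stable
under `L_0`. -/
theorem orbifoldProd_eta_omega_eta (a : V) :
    A.orbifoldProd d 1 (A.eta d A.omega) (A.eta d a) = A.eta d (A.prod 1 A.omega a) := by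
  refine Subtype.ext ?_
  rw [coe_orbifoldProd, coe_eta, coe_eta, tensorProd_etaTensor, coe_eta, etaTensor_apply,
    etaTensor_apply]
  refine Finset.sum_congr rfl fun i _ => ?_
  rw [map_sum, Finset.sum_eq_single i]
  · simp [factorAct_tprod]
  · intro l _ hl
    rw [factorAct_tprod]
    refine (PiTensorProduct.tprod ℂ).map_coord_zero i ?_
    simp [hl.symm, A.prod_vac 1 A.omega one_pos.le]
  · simp

/-! ### Weights -/

/-- If `η̄` has finite rank, it kills all vectors of large weight. -/
theorem exists_eta_mem_C2Subspace [FiniteDimensional ℂ (LinearMap.range (A.etaBar d))] :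
    ∃ N : ℤ, ∀ n : ℤ, N ≤ n → ∀ a ∈ Module.End.eigenspace (A.prod 1 A.omega) (n : ℂ),
      A.eta d a ∈ C2Subspace (A.orbifoldProd d) := by
  let K : Submodule ℂ V := LinearMap.ker (A.etaBar d)
  have hK : ∀ a, a ∈ K ↔ A.eta d a ∈ C2Subspace (A.orbifoldProd d) := fun a => by
    simp [K, etaBar]
  have : FiniteDimensional ℂ (V ⧸ K) :=
    Module.Finite.equiv (A.etaBar d).quotKerEquivRange.symm
  have hL : K ≤ K.comap (A.prod 1 A.omega) := fun a ha => by
    rw [Submodule.mem_comap, hK, ← orbifoldProd_eta_omega_eta]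
    exact A.orbifoldProd_eta_omega_mem_C2Subspace ((hK a).mp ha)
  let L : Module.End ℂ (V ⧸ K) := K.mapQ K (A.prod 1 A.omega) hL
  have hfin : {n : ℤ | L.HasEigenvalue (n : ℂ)}.Finite :=
    L.finite_hasEigenvalue.preimage Int.cast_injective.injOn
  obtain ⟨N, hN⟩ := hfin.bddAbove
  refine ⟨N + 1, fun n hn a ha => (hK a).mp ?_⟩
  by_contra hc
  -- A weight `n` vector outside `K` has nonzero image in `V ⧸ K`, an eigenvector of `L` for `n`.
  have hev : L.HasEigenvalue (n : ℂ) := by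
    refine Module.End.hasEigenvalue_of_hasEigenvector (x := K.mkQ a) ⟨?_, ?_⟩
    · rw [Module.End.mem_eigenspace_iff] at ha ⊢
      simp [L, ha]
    · simpa using hc
  have := hN hev
  omega

/-- The sum of the weight spaces `V_w` with `n ≤ w`. -/
noncomputable def weightGE (n : ℤ) : Submodule ℂ V :=
  ⨆ w : Set.Ici n, Module.End.eigenspace (A.prod 1 A.omega) ((w : ℤ) : ℂ)

theorem eigenspace_le_weightGE {n w : ℤ} (h : n ≤ w) :
    Module.End.eigenspace (A.prod 1 A.omega) (w : ℂ) ≤ A.weightGE n :=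
  le_iSup (fun w : Set.Ici n => Module.End.eigenspace (A.prod 1 A.omega) ((w : ℤ) : ℂ)) ⟨w, h⟩

theorem weightGE_anti {m n : ℤ} (h : m ≤ n) : A.weightGE n ≤ A.weightGE m :=
  iSup_le fun w => A.eigenspace_le_weightGE (h.trans w.2)

theorem iSup_eigenspace :
    ⨆ n : ℤ, Module.End.eigenspace (A.prod 1 A.omega) (n : ℂ) = ⊤ :=
  A.grading.submodule_iSup_eq_top

/-- `[L_0, b_(-1)] = (L_{-1} b)_(0) + (L_0 b)_(-1)`, and the first term is zero by the derivation
rule. -/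
theorem prod_neg_one_mem_eigenspace {m n : ℤ} {a b : V}
    (hb : b ∈ Module.End.eigenspace (A.prod 1 A.omega) (m : ℂ))
    (ha : a ∈ Module.End.eigenspace (A.prod 1 A.omega) (n : ℂ)) :
    A.prod (-1) b a ∈ Module.End.eigenspace (A.prod 1 A.omega) ((m + n : ℤ) : ℂ) := by
  rw [Module.End.mem_eigenspace_iff] at ha hb ⊢
  obtain ⟨N, hN⟩ := A.truncation A.omega b
  have h := A.prod_commutator 1 (-1) A.omega b a (N := max 2 N.toNat) fun j hj =>
    hN j (Int.toNat_le.mp ((le_max_right _ _).trans hj))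
  rw [← Finset.sum_subset (Finset.range_subset_range.mpr (le_max_left 2 N.toNat))] at h
  · rw [ha, sub_eq_iff_eq_add] at h
    rw [h]
    simp [Finset.sum_range_succ, hb, A.derivation, add_smul]
  · intro j _ hj
    have : Ring.choose (1 : ℤ) j = 0 := by
      have h1 := Ring.choose_natCast (R := ℤ) 1 j
      rw [Nat.cast_one] at h1
      rw [h1, Nat.choose_eq_zero_of_lt (by simpa using hj), Nat.cast_zero]
    simp [this]

/-- Every homogeneous component of `b` has weight at least `-M`. -/
theorem prod_neg_one_mem_weightGE {M : ℤ}
    (hM : ∀ n : ℤ, n < -M → Module.End.eigenspace (A.prod 1 A.omega) (n : ℂ) = ⊥)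
    {n : ℤ} (b : V) {a : V} (ha : a ∈ A.weightGE n) : A.prod (-1) b a ∈ A.weightGE (n - M) := by
  have hb : b ∈ ⨆ n : ℤ, Module.End.eigenspace (A.prod 1 A.omega) (n : ℂ) :=
    A.iSup_eigenspace ▸ Submodule.mem_top
  induction hb using Submodule.iSup_induction' with
  | zero => simp
  | add x y _ _ hx hy =>
    rw [map_add, LinearMap.add_apply]
    exact Submodule.add_mem _ hx hy
  | mem m b hb =>
    by_cases hm : m < -M
    · rw [hM m hm, Submodule.mem_bot] at hb
      simp [hb]
    · induction ha using Submodule.iSup_induction' with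
      | zero => simp
      | add x y _ _ hx hy => rw [map_add]; exact Submodule.add_mem _ hx hy
      | mem w a ha =>
        have hw : n ≤ w := w.2
        exact A.eigenspace_le_weightGE (by omega) (A.prod_neg_one_mem_eigenspace hb ha)

/-! ### Pure tensors with an entry of large weight -/

theorem symmetrise_tprod_mem_C2Subspace (hd : 0 < d) {N M : ℤ} (hM₀ : 0 ≤ M)
    (hM : ∀ n : ℤ, n < -M → Module.End.eigenspace (A.prod 1 A.omega) (n : ℂ) = ⊥)
    (hN : ∀ a ∈ A.weightGE N, A.eta d a ∈ C2Subspace (A.orbifoldProd d))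
    (r : ℕ) (T : Finset (Fin d)) (hT : T.card = r) (a : Fin d → V)
    (hvac : ∀ i, i ∉ T → a i = A.vac) (i₀ : Fin d) (hi₀ : i₀ ∈ T)
    (ha : a i₀ ∈ A.weightGE (N + r * M)) :
    symmetrise V d (PiTensorProduct.tprod ℂ a) ∈ C2Subspace (A.orbifoldProd d) := by
  induction r generalizing T a with
  | zero => simp [Finset.card_eq_zero.mp hT] at hi₀
  | succ r ih =>
    have symm_update : ∀ (c : Fin d → V) (i j : Fin d) (b : V), c i = c j →
        symmetrise V d (PiTensorProduct.tprod ℂ (Function.update c i b)) =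
          symmetrise V d (PiTensorProduct.tprod ℂ (Function.update c j b)) := by
      intro c i j b hc
      rw [← symmetrise_permAct V (Equiv.swap i j), permAct_tprod]
      congr 2
      funext l
      by_cases hl : l = j
      · subst hl; simp
      · by_cases hl' : l = i
        · subst hl'
          simp only [Equiv.symm_swap, Equiv.swap_apply_left]
          rw [Function.update_of_ne hl, Function.update_of_ne (Ne.symm hl), hc]
        · simp [Equiv.swap_apply_of_ne_of_ne hl' hl, hl, hl']
    by_cases hex : ∃ i₁ ∈ T, i₁ ≠ i₀
    · obtain ⟨i₁, hi₁, hne⟩ := hex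
      have hT' : (T.erase i₁).card = r := by rw [Finset.card_erase_of_mem hi₁, hT]; simp
      have hi₀' : i₀ ∈ T.erase i₁ := Finset.mem_erase.mpr ⟨hne.symm, hi₀⟩
      -- Slot `i₁` is emptied so that induction applies; `η(a i₁)_(-1)` then puts the entry back.
      set a' := Function.update a i₁ A.vac with ha'
      have hvac' : ∀ i, i ∉ T.erase i₁ → a' i = A.vac := by
        intro i hi
        by_cases h : i = i₁
        · subst h; simp [ha']
        · rw [ha', Function.update_of_ne h]
          exact hvac i fun hc => hi (Finset.mem_erase.mpr ⟨h, hc⟩)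
      have hai₀ : a' i₀ = a i₀ := Function.update_of_ne hne.symm _ _
      have hle : N + r * M ≤ N + (r + 1 : ℕ) * M := by push_cast; linarith
      have h₁ := A.orbifoldProd_eta_neg_one_mem_C2Subspace (a i₁)
        (ih _ hT' a' hvac' hi₀' (hai₀ ▸ A.weightGE_anti hle ha))
      rw [orbifoldProd_eta_symmetrise, ← Finset.sum_add_sum_compl (T.erase i₁)] at h₁
      -- Multiplying an entry already present creates no new non-vacuum slot, and the entry at `i₀`
      -- loses at most `M` in weight.
      have h₂ : ∑ i ∈ T.erase i₁, symmetrise V d (PiTensorProduct.tprod ℂ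
          (Function.update a' i (A.prod (-1) (a i₁) (a' i)))) ∈
            C2Subspace (A.orbifoldProd d) := by
        refine Submodule.sum_mem _ fun i hi => ih _ hT' _ ?_ hi₀' ?_
        · intro l hl
          rw [Function.update_of_ne (fun hc : l = i => hl (hc.symm ▸ hi)), hvac' l hl]
        · by_cases h : i₀ = i
          · subst h
            rw [Function.update_self, hai₀]
            have := A.prod_neg_one_mem_weightGE hM (a i₁) ha
            rwa [show N + ((r + 1 : ℕ) : ℤ) * M - M = N + r * M by push_cast; ring] at this
          · rw [Function.update_of_ne h, hai₀]
            exact A.weightGE_anti hle ha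
      have h₃ := (Submodule.add_mem_iff_right _ h₂).mp h₁
      -- In each remaining slot `a i₁` replaces a vacuum, giving `a` up to a swap with `i₁`; the
      -- number of such slots is nonzero because `i₁` is one of them.
      rw [Finset.sum_congr rfl (g := fun _ => symmetrise V d (PiTensorProduct.tprod ℂ a)),
        Finset.sum_const, ← Nat.cast_smul_eq_nsmul ℂ] at h₃
      · refine (Submodule.smul_mem_iff _ (Nat.cast_ne_zero.mpr ?_)).mp h₃
        exact Finset.card_ne_zero_of_mem (a := i₁) (by simp)
      · intro i hi
        have hai := hvac' i (Finset.mem_compl.mp hi)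
        rw [hai, A.prod_neg_one_vac, symm_update a' i i₁ _ (by rw [hai, hvac' i₁ (by simp)]),
          ha', Function.update_idem, Function.update_eq_self]
    -- Here `T = {i₀}`: symmetrising `η(a i₀)` gives both `d!` times itself and `d` times the
    -- symmetrisation of `a`.
    · push Not at hex
      have haeq : a = Function.update (fun _ => A.vac) i₀ (a i₀) := by
        funext l
        by_cases hl : l = i₀
        · subst hl; simp
        · rw [Function.update_of_ne hl]
          exact hvac l fun hc => hl (hex l hc)
      have hle : N ≤ N + (r + 1 : ℕ) * M := by
        have : 0 ≤ ((r + 1 : ℕ) : ℤ) * M := by positivity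
        linarith
      have h := Submodule.smul_mem _ (d.factorial : ℂ) (hN _ (A.weightGE_anti hle ha))
      rw [← symmetrise_coe, coe_eta, etaTensor_apply, map_sum,
        Finset.sum_congr rfl (g := fun _ => symmetrise V d (PiTensorProduct.tprod ℂ a)),
        Finset.sum_const, ← Nat.cast_smul_eq_nsmul ℂ] at h
      · refine (Submodule.smul_mem_iff _ (Nat.cast_ne_zero.mpr ?_)).mp h
        simpa using hd.ne'
      · intro i _
        rw [symm_update _ i i₀ _ rfl, ← haeq]

end VertexOperatorAlgebra

/-! ### The equivalence -/

theorem mainTheorem4 {V : Type*} [AddCommGroup V] [Module ℂ V] (A : VertexOperatorAlgebra V)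
    (d : ℕ) (hd : 0 < d) :
    IsC2Cofinite (A.orbifoldProd d) ↔ FiniteDimensional ℂ (LinearMap.range (A.etaBar d)) := by
  constructor
  · intro h
    have : FiniteDimensional ℂ (C2Quotient (A.orbifoldProd d)) := h
    infer_instance
  · intro h
    obtain ⟨N, hN⟩ := A.exists_eta_mem_C2Subspace (d := d)
    obtain ⟨M₀, hM₀⟩ := A.bounded_weight
    -- `M` is made nonnegative so that the thresholds `N + r * M` do not decrease with `r`.
    set M : ℤ := max 0 (-M₀) with hMdef
    have hM : ∀ n : ℤ, n < -M → Module.End.eigenspace (A.prod 1 A.omega) (n : ℂ) = ⊥ :=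
      fun n hn => hM₀ n (by omega)
    have hN' : ∀ a ∈ A.weightGE N, A.eta d a ∈ C2Subspace (A.orbifoldProd d) := by
      suffices A.weightGE N ≤ (C2Subspace (A.orbifoldProd d)).comap (A.eta d) from this
      exact iSup_le fun w a ha => hN w w.2 a ha
    -- All `d` slots may be non-vacuum, hence the threshold with `r = d`.
    set F : Submodule ℂ V := A.weightGE (N + d * M)
    set G : Submodule ℂ V := ⨆ n : Finset.Ico (-M) (N + d * M),
      Module.End.eigenspace (A.prod 1 A.omega) ((n : ℤ) : ℂ)
    have : ∀ n : ℤ, FiniteDimensional ℂ (Module.End.eigenspace (A.prod 1 A.omega) (n : ℂ)) :=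
      A.finite_weight
    have hG : FiniteDimensional ℂ G := Submodule.finiteDimensional_iSup _
    have hGF : G ⊔ F = ⊤ := by
      rw [← top_le_iff, ← A.iSup_eigenspace]
      refine iSup_le fun n => ?_
      by_cases h₁ : n < -M
      · rw [hM n h₁]; exact bot_le
      · by_cases h₂ : n < N + d * M
        · refine le_sup_of_le_left ?_
          exact le_iSup (fun n : Finset.Ico (-M) (N + d * M) =>
            Module.End.eigenspace (A.prod 1 A.omega) ((n : ℤ) : ℂ))
            ⟨n, Finset.mem_Ico.mpr ⟨not_lt.mp h₁, h₂⟩⟩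
        · exact le_sup_of_le_right (A.eigenspace_le_weightGE (not_lt.mp h₂))
    have hfin := PiTensorProduct.finiteDimensional_range_of_forall_tprod_eq_zero
      ((C2Subspace (A.orbifoldProd d)).mkQ ∘ₗ symmetrise V d) F G hGF fun a i hi => by
        have := A.symmetrise_tprod_mem_C2Subspace hd (le_max_left 0 (-M₀)) hM hN' d
          Finset.univ (by simp) a (by simp) i (Finset.mem_univ i) hi
        simpa using this
    -- The composite is onto, so its finite-dimensional range is all of `R(W)`.
    rw [LinearMap.range_comp, range_symmetrise, Submodule.map_top, Submodule.range_mkQ] at hfin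
    exact Module.Finite.equiv Submodule.topEquiv
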